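/- Let $\mathcal C$ be an abelian category with enough projectives. A projective resolution $A_\bullet=(A_i)_{i\ge 0}$ of an object $A$, with differentials $a_i:A_i\to A_{i-1}$, is extended by zero to negative degrees. Its syzygies are $\widetilde A_0=A$ and $\widetilde A_{k+1}=\mathrm{Ker}(A_k\to\widetilde A_k)$. Write $\pi_k: A_k\to\widetilde A_k$ for the canonical epimorphism. For projective resolutions $A_\bullet$, $B_\bullet$ of objects $A$, $B$ and $n\in\mathbb Z$, the $n$-th completed unenriched Ext group is given by two constructions. * *Hypercohomology construction.* Let $\mathrm{Hyp}^n(A_\bullet,B_\bullet)=\prod_{k\in\mathbb Z}\mathrm{Hom}_{\mathcal C}(A_{n+k},B_k)$ with differential $d^n(\varphi)_k=b_{k+1}\varphi_{k+1}-(-1)^n\varphi_k a_{n+k+1}$, where $\varphi_k:A_{n+k}\to B_k$. Let $\mathrm{Bdd}^n$ be the subcomplex of the families with only finitely many nonzero members, and let $\mathrm{Vog}=\mathrm{Hyp}/\mathrm{Bdd}$. Then $\widehat{\mathrm{Ext}}{}^n_{\mathrm{Vog}}(A,B)=H^n(\mathrm{Vog}(A_\bullet,B_\bullet))$. Its elements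 are the classes $[\varphi]$ of almost chain maps of degree $n$, that is, of $\varphi\in\mathrm{Hyp}^n$ with $d^n\varphi\in\mathrm{Bdd}^{n+1}$. * *Naïve construction.* Let $[X,Y]_{\mathcal C}$ be $\mathrm{Hom}_{\mathcal C}(X,Y)$ modulo the morphisms that factor through a projective object. Then $\widehat{\mathrm{Ext}}{}^n_{\mathrm{BC}}(A,B)=\varinjlim_{k\ge 0,\,n+k\ge 0}[\widetilde A_{n+k},\widetilde B_k]_{\mathcal C}$, where the transition map sends the class of $f$ to the class of the morphism $\widetilde A_{n+k+1}\to\widetilde B_{k+1}$ induced by a lift $A_{n+k}\to B_k$ of $f$. Write $\iota_k$ for the canonical map of the $k$-th term to the direct limit. **Theorem.** There are isomorphisms of abelian groups $$\theta^n_{A,B}:\widehat{\mathrm{Ext}}{}^n_{\mathrm{Vog}}(A,B)\to\widehat{\mathrm{Ext}}{}^n_{\mathrm{BC}}(A,B)$$ for all objects $A,B$, all projective resolutions of them and all $n\in\mathbb Z$, described as follows. If $\varphi$ is an almost chain map of degree $n$ with $(d^n\varphi)_k=0$ for all $k\ge K$, where $K\ge 0$, then for every $k\ge K$ with $n+k\ge0$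 the morphism $\varphi_k$ induces a morphism $\widetilde\varphi_k:\widetilde A_{n+k}\to\widetilde B_k$ with $\pi_k\varphi_k=\widetilde\varphi_k\pi_{n+k}$, and $$\theta^n_{A,B}([\varphi])=(-1)^{n(n-1)/2+nk}\,\iota_k[\widetilde\varphi_k].$$ Let moreover $F,H,J$ be objects of $\mathcal C$ with projective resolutions, let $m,n\in\mathbb Z$, and let $\otimes$ be the tensor product of abelian groups. Then Yoneda products $$\circ:\widehat{\mathrm{Ext}}{}^n(H,J)\otimes\widehat{\mathrm{Ext}}{}^m(F,H)\to\widehat{\mathrm{Ext}}{}^{m+n}(F,J)$$ are defined by each of the two constructions, as follows. 1. In the hypercohomology construction, the composite $(g\circ f)_k=g_k\circ f_{n+k}$ of almost chain maps $g$ of degree $n$ and $f$ of degree $m$ is an almost chain map of degree $m+n$, and there is a homomorphism with $[g]\otimes[f]\mapsto[g\circ f]$. 2. In the naïve construction, there is a homomorphism with $\iota_k(y)\otimes\iota_{n+k}(x)\mapsto\iota_k(y\circ x)$ for all $k\ge 0$ with $n+k\ge0$ and $m+n+k\ge0$, all $y\in[\widetilde H_{n+k},\widetilde J_k]_{\mathcal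 C}$ and all $x\in[\widetilde F_{m+n+k},\widetilde H_{n+k}]_{\mathcal C}$, where $y\circ x\in[\widetilde F_{m+n+k},\widetilde J_k]_{\mathcal C}$ is the class of the composite. It is thus the direct limit of the composition maps of the functors $[-,-]_{\mathcal C}$. 3. The two products agree: $\theta^{m+n}_{F,J}(y\circ x)=\theta^n_{H,J}(y)\circ\theta^m_{F,H}(x)$ for all $y\in\widehat{\mathrm{Ext}}{}^n_{\mathrm{Vog}}(H,J)$ and $x\in\widehat{\mathrm{Ext}}{}^m_{\mathrm{Vog}}(F,H)$. -/

import Mathlib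

open CategoryTheory CategoryTheory.Limits TensorProduct
open CochainComplex.HomComplex

universe v u

noncomputable section

namespace CompletedExt

variable {C : Type u} [Category.{v} C] [Abelian C]

/-! ## The stable Hom groups `[X, Y]` -/

/-- The subgroup of `Hom(X, Y)` of all morphisms that factor through a projective object. -/
def projSubgroup (X Y : C) : AddSubgroup (X ⟶ Y) where
  carrier := {f | ∃ (P : C) (_ : Projective P) (a : X ⟶ P) (b : P ⟶ Y), a ≫ b = f}
  zero_mem' := ⟨⊥_ C, Projective.of_iso (isZero_zero C |>.iso (initialIsInitial.isZero)) inferInstance, 0, 0, by simp⟩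
  add_mem' := by
    rintro _ _ ⟨P, hP, a, b, rfl⟩ ⟨Q, hQ, c, d, rfl⟩
    exact ⟨P ⊞ Q, inferInstance, biprod.lift a c, biprod.desc b d, by simp⟩
  neg_mem' := by
    rintro _ ⟨P, hP, a, b, rfl⟩
    exact ⟨P, hP, a, -b, by simp⟩

/-- The stable Hom group `[X, Y]`: morphisms modulo those factoring through a projective. -/
abbrev StableHom (X Y : C) : Type v := (X ⟶ Y) ⧸ projSubgroup X Y

/-- The class of a morphism in the stable Hom group. -/
abbrev stableMk {X Y : C} : (X ⟶ Y) →+ StableHom X Y := QuotientAddGroup.mk' (projSubgroup X Y)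

theorem comp_mem_left {X Y Z : C} {f : X ⟶ Y} (hf : f ∈ projSubgroup X Y) (g : Y ⟶ Z) :
    f ≫ g ∈ projSubgroup X Z := by
  obtain ⟨P, hP, a, b, rfl⟩ := hf
  exact ⟨P, hP, a, b ≫ g, by simp⟩

theorem comp_mem_right {X Y Z : C} (f : X ⟶ Y) {g : Y ⟶ Z} (hg : g ∈ projSubgroup Y Z) :
    f ≫ g ∈ projSubgroup X Z := by
  obtain ⟨P, hP, a, b, rfl⟩ := hg
  exact ⟨P, hP, f ≫ a, b, by simp⟩

/-- Composition in the stable Hom groups, `[Y, Z] × [X, Y] → [X, Z]`, `([g], [f]) ↦ [g ∘ f]`,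
as a biadditive map. -/
def stableComp (X Y Z : C) : StableHom Y Z →+ StableHom X Y →+ StableHom X Z :=
  QuotientAddGroup.lift (projSubgroup Y Z)
    (AddMonoidHom.mk'
      (fun g => QuotientAddGroup.map (projSubgroup X Y) (projSubgroup X Z)
        (Preadditive.rightComp X g) (fun _ hf => comp_mem_left hf g))
      (fun g g' => by
        ext f
        exact congrArg stableMk (Preadditive.comp_add _ _ _ f g g')))
    (fun g hg => by
      ext f
      exact (QuotientAddGroup.eq_zero_iff _).2 (comp_mem_right f hg))

@[simp]
theorem stableComp_mk {X Y Z : C} (g : Y ⟶ Z) (f : X ⟶ Y) :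
    stableComp X Y Z (stableMk g) (stableMk f) = stableMk (f ≫ g) := rfl

/-! ## Syzygies of a projective resolution -/

variable {A B : C}

/-- The `k`-th syzygy `obj` of a projective resolution `P`, together with the canonical epimorphism
`P_k ⟶ obj` and the exactness of `P_{k+1} ⟶ P_k ⟶ obj ⟶ 0`. -/
structure SyzygyStage (P : ProjectiveResolution A) (k : ℕ) where
  obj : C
  proj : P.complex.X k ⟶ obj
  epi : Epi proj
  w : P.complex.d (k + 1) k ≫ proj = 0
  exact : (ShortComplex.mk _ _ w).Exact

/-- The `0`-th syzygy is the resolved object with its augmentation. -/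
def syzygyZero (P : ProjectiveResolution A) : SyzygyStage P 0 where
  obj := A
  proj := P.π.f 0
  epi := inferInstanceAs (Epi (P.π.f 0))
  w := P.complex_d_comp_π_f_zero
  exact := ShortComplex.exact_of_g_is_cokernel _ P.isColimitCokernelCofork

/-- The `(k+1)`-st syzygy is the kernel of the epimorphism from `P_k` onto the `k`-th syzygy. -/
def syzygySucc (P : ProjectiveResolution A) (k : ℕ) (S : SyzygyStage P k) :
    SyzygyStage P (k + 1) where
  obj := kernel S.proj
  proj := kernel.lift S.proj (P.complex.d (k + 1) k) S.w
  epi := (ShortComplex.exact_iff_epi_kernel_lift _).1 S.exact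
  w := by
    rw [← cancel_mono (kernel.ι S.proj)]
    simp
  exact := by
    have w' : P.complex.d (k + 2) (k + 1) ≫
        kernel.lift S.proj (P.complex.d (k + 1) k) S.w = 0 := by
      rw [← cancel_mono (kernel.ι S.proj)]
      simp
    let φ : ShortComplex.mk _ _ w' ⟶
        ShortComplex.mk _ _ (P.complex.d_comp_d (k + 2) (k + 1) k) :=
      { τ₁ := 𝟙 _
        τ₂ := 𝟙 _
        τ₃ := kernel.ι S.proj }
    have : Epi φ.τ₁ := inferInstanceAs (Epi (𝟙 _))
    have : IsIso φ.τ₂ := inferInstanceAs (IsIso (𝟙 _))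
    have : Mono φ.τ₃ := inferInstanceAs (Mono (kernel.ι S.proj))
    exact (ShortComplex.exact_iff_of_epi_of_isIso_of_mono φ).2 (P.exact_succ k)

def syzygyStage (P : ProjectiveResolution A) : ∀ k : ℕ, SyzygyStage P k
  | 0 => syzygyZero P
  | k + 1 => syzygySucc P k (syzygyStage P k)

/-- The `k`-th syzygy of a projective resolution `P` of `A`: the `0`-th one is `A`, and the
`(k+1)`-st one is the kernel of the epimorphism from `P_k` onto the `k`-th one. -/
def syz (P : ProjectiveResolution A) (k : ℕ) : C := (syzygyStage P k).obj

/-- The epimorphism from `P_k` onto the `k`-th syzygy. -/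
def syzπ (P : ProjectiveResolution A) (k : ℕ) : P.complex.X k ⟶ syz P k := (syzygyStage P k).proj

instance (P : ProjectiveResolution A) (k : ℕ) : Epi (syzπ P k) := (syzygyStage P k).epi

/-- The inclusion of the `(k+1)`-st syzygy, the kernel of `syzπ P k`, into `P_k`. -/
def syzι (P : ProjectiveResolution A) (k : ℕ) : syz P (k + 1) ⟶ P.complex.X k :=
  kernel.ι (syzygyStage P k).proj

instance (P : ProjectiveResolution A) (k : ℕ) : Mono (syzι P k) :=
  inferInstanceAs (Mono (kernel.ι _))

@[simp]
theorem syzι_syzπ (P : ProjectiveResolution A) (k : ℕ) : syzι P k ≫ syzπ P k = 0 :=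
  kernel.condition _

@[simp]
theorem syzι_syzπ_assoc (P : ProjectiveResolution A) (k : ℕ) {X : C} (f : syz P k ⟶ X) :
    syzι P k ≫ syzπ P k ≫ f = 0 := by
  rw [← Category.assoc, syzι_syzπ, zero_comp]

/-- The factorisation through the `(k+1)`-st syzygy of a morphism that is killed by `syzπ P k`. -/
def syzLift (P : ProjectiveResolution A) (k : ℕ) {X : C} (g : X ⟶ P.complex.X k)
    (hg : g ≫ syzπ P k = 0) : X ⟶ syz P (k + 1) :=
  kernel.lift _ g hg

@[simp]
theorem syzLift_syzι (P : ProjectiveResolution A) (k : ℕ) {X : C} (g : X ⟶ P.complex.X k)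
    (hg : g ≫ syzπ P k = 0) : syzLift P k g hg ≫ syzι P k = g :=
  kernel.lift_ι _ _ _

/-! ## The naïve construction -/

section Naive

variable (PA : ProjectiveResolution A) (PB : ProjectiveResolution B)

/-- A lift `PA_i ⟶ PB_k` of a morphism between the syzygies. -/
def liftMap {i k : ℕ} (f : syz PA i ⟶ syz PB k) : PA.complex.X i ⟶ PB.complex.X k :=
  Projective.factorThru (syzπ PA i ≫ f) (syzπ PB k)

theorem liftMap_syzπ {i k : ℕ} (f : syz PA i ⟶ syz PB k) :
    liftMap PA PB f ≫ syzπ PB k = syzπ PA i ≫ f :=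
  Projective.factorThru_comp _ _

/-- The morphism between the next syzygies which is induced by the lift of `f`. -/
def nextMap {i k : ℕ} (f : syz PA i ⟶ syz PB k) : syz PA (i + 1) ⟶ syz PB (k + 1) :=
  syzLift PB k (syzι PA i ≫ liftMap PA PB f) (by simp [liftMap_syzπ])

theorem nextMap_syzι {i k : ℕ} (f : syz PA i ⟶ syz PB k) :
    nextMap PA PB f ≫ syzι PB k = syzι PA i ≫ liftMap PA PB f :=
  syzLift_syzι _ _ _ _

/-- If `f` factors through a projective, then so does any morphism induced by `f` on the next
syzygies, whatever lift is taken. -/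
theorem next_mem {i k : ℕ} {f : syz PA i ⟶ syz PB k} {g : PA.complex.X i ⟶ PB.complex.X k}
    {f' : syz PA (i + 1) ⟶ syz PB (k + 1)} (hg : g ≫ syzπ PB k = syzπ PA i ≫ f)
    (hf' : f' ≫ syzι PB k = syzι PA i ≫ g) (hf : f ∈ projSubgroup _ _) :
    f' ∈ projSubgroup _ _ := by
  obtain ⟨P, hP, a, b, rfl⟩ := hf
  refine ⟨PA.complex.X i, inferInstance, syzι PA i,
    syzLift PB k (g - syzπ PA i ≫ a ≫ Projective.factorThru b (syzπ PB k)) ?_, ?_⟩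
  · simp [Preadditive.sub_comp, hg]
  · rw [← cancel_mono (syzι PB k)]
    simp [Preadditive.comp_sub, hf']

/-- The transition homomorphism `[syz PA i, syz PB k] → [syz PA (i+1), syz PB (k+1)]`, sending the
class of `f` to the class of the morphism induced on kernels by a lift of `f`. -/
def stableNext (i k : ℕ) :
    StableHom (syz PA i) (syz PB k) →+ StableHom (syz PA (i + 1)) (syz PB (k + 1)) :=
  QuotientAddGroup.lift (projSubgroup _ _)
    (AddMonoidHom.mk' (fun f => stableMk (nextMap PA PB f)) (fun f f' => by
      rw [← map_add, ← sub_eq_zero, ← map_sub]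
      refine (QuotientAddGroup.eq_zero_iff _).2 (next_mem PA PB (f := 0)
        (g := liftMap PA PB (f + f') - (liftMap PA PB f + liftMap PA PB f')) ?_ ?_ (zero_mem _))
      · simp [Preadditive.sub_comp, Preadditive.add_comp, liftMap_syzπ]
      · simp [Preadditive.sub_comp, Preadditive.add_comp, nextMap_syzι]))
    (fun f hf => (QuotientAddGroup.eq_zero_iff _).2
      (next_mem PA PB (liftMap_syzπ PA PB f) (nextMap_syzι PA PB f) hf))

/-- The transition homomorphism does not depend on the choice of the lift. -/
theorem stableNext_mk {i k : ℕ} {f : syz PA i ⟶ syz PB k} {g : PA.complex.X i ⟶ PB.complex.X k}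
    {f' : syz PA (i + 1) ⟶ syz PB (k + 1)} (hg : g ≫ syzπ PB k = syzπ PA i ≫ f)
    (hf' : f' ≫ syzι PB k = syzι PA i ≫ g) :
    stableNext PA PB i k (stableMk f) = stableMk f' := by
  change stableMk (nextMap PA PB f) = stableMk f'
  rw [← sub_eq_zero, ← map_sub]
  refine (QuotientAddGroup.eq_zero_iff _).2 (next_mem PA PB (f := 0)
    (g := liftMap PA PB f - g) ?_ ?_ (zero_mem _))
  · simp [Preadditive.sub_comp, liftMap_syzπ, hg]
  · simp [Preadditive.sub_comp, nextMap_syzι, hf']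

/-- The `j`-fold iterate of the transition homomorphisms. -/
def stableIter (i k : ℕ) : ∀ j : ℕ,
    StableHom (syz PA i) (syz PB k) →+ StableHom (syz PA (i + j)) (syz PB (k + j))
  | 0 => AddMonoidHom.id _
  | j + 1 => (stableNext PA PB (i + j) (k + j)).comp (stableIter i k j)

/-- `stableIter` with free names for the target indices. -/
def transition {i k i' k' : ℕ} (j : ℕ) (hi : i + j = i') (hk : k + j = k') :
    StableHom (syz PA i) (syz PB k) →+ StableHom (syz PA i') (syz PB k') := by
  subst hi hk
  exact stableIter PA PB i k j

theorem transition_zero {i k : ℕ} (j : ℕ) (hi : i + j = i) (hk : k + j = k)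
    (x : StableHom (syz PA i) (syz PB k)) : transition PA PB j hi hk x = x := by
  obtain rfl : j = 0 := by omega
  rfl

theorem transition_succ {i k i' k' : ℕ} (j : ℕ) (hi : i + j = i') (hk : k + j = k')
    (hi' : i + (j + 1) = i' + 1) (hk' : k + (j + 1) = k' + 1)
    (x : StableHom (syz PA i) (syz PB k)) :
    transition PA PB (j + 1) hi' hk' x = stableNext PA PB i' k' (transition PA PB j hi hk x) := by
  subst hi hk
  rfl

theorem transition_trans {i k i' k' i'' k'' : ℕ} (j l s : ℕ) (hi : i + j = i') (hk : k + j = k')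
    (hi' : i' + l = i'') (hk' : k' + l = k'') (hi'' : i + s = i'') (hk'' : k + s = k'')
    (x : StableHom (syz PA i) (syz PB k)) :
    transition PA PB l hi' hk' (transition PA PB j hi hk x) = transition PA PB s hi'' hk'' x := by
  induction l generalizing i'' k'' s with
  | zero =>
    subst hi hk hi' hk'
    obtain rfl : s = j := by omega
    rfl
  | succ l ih =>
    obtain rfl : s = (j + l) + 1 := by omega
    subst hi' hk'
    rw [transition_succ PA PB (j + l) (i' := i' + l) (k' := k' + l) (by omega) (by omega),
      ← ih (j + l) rfl rfl (by omega) (by omega)]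
    exact transition_succ PA PB l rfl rfl rfl rfl _

/-- The index set of the direct system in degree `n`: pairs `(n + k, k)` of natural numbers, that
is, all `k ≥ 0` with `n + k ≥ 0`, ordered by `k`. -/
abbrev StageIndex (n : ℤ) : Type := {p : ℕ × ℕ // (p.1 : ℤ) = n + p.2}

/-- The group at stage `(n + k, k)`. -/
abbrev naiveStage (n : ℤ) (p : StageIndex n) : Type v :=
  StableHom (syz PA p.1.1) (syz PB p.1.2)

/-- The transition homomorphisms of the direct system. -/
def naiveMap (n : ℤ) (p q : StageIndex n) (h : p ≤ q) :
    naiveStage PA PB n p →+ naiveStage PA PB n q :=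
  transition PA PB (q.1.2 - p.1.2)
    (by have h1 : p.1.1 ≤ q.1.1 := h.1
        have h2 : p.1.2 ≤ q.1.2 := h.2
        have := p.2; have := q.2; omega)
    (by have h2 : p.1.2 ≤ q.1.2 := h.2
        omega)

instance (n : ℤ) : DirectedSystem (naiveStage PA PB n) (fun p q h => naiveMap PA PB n p q h) where
  map_self _ _ := transition_zero _ _ _ _ _ _
  map_map _ _ _ _ _ _ := transition_trans _ _ _ _ _ _ _ _ _ _ _ _

/-- The naïve construction of the `n`-th completed Ext group: the direct limit over all `k ≥ 0`
with `n + k ≥ 0` of the stable Hom groups `[syz PA (n+k), syz PB k]`. -/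
abbrev NaiveExt (n : ℤ) : Type v :=
  AddCommGroup.DirectLimit (naiveStage PA PB n) (naiveMap PA PB n)

/-- The canonical map of `[syz PA i, syz PB k]`, with `i = n + k`, to the direct limit. -/
def naiveOf (n : ℤ) (i k : ℕ) (h : (i : ℤ) = n + k) :
    StableHom (syz PA i) (syz PB k) →+ NaiveExt PA PB n :=
  AddCommGroup.DirectLimit.of (naiveStage PA PB n) (naiveMap PA PB n) ⟨(i, k), h⟩

end Naive

/-! ## The hypercohomology construction -/

section Vogel

variable (PA : ProjectiveResolution A) (PB : ProjectiveResolution B)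

/-- The group of `n`-cochains of the hypercohomology complex: families of morphisms
`PA_{n+k} ⟶ PB_k` for all integers `k`, where the resolutions are extended by zero to negative
degrees. A resolution is regarded here as a cochain complex, so `PA_i` sits in degree `-i`. The
differential is `δ`, which sends `φ` to the family `b ∘ φ - (-1) ^ n φ ∘ a`. -/
abbrev Hyp (n : ℤ) : Type v := Cochain PA.cochainComplex PB.cochainComplex n

/-- The bounded subcomplex: families with only finitely many nonzero members. -/
def bdd (n : ℤ) : AddSubgroup (Hyp PA PB n) where
  carrier := {φ | {p : ℤ | φ.v p (p + n) rfl ≠ 0}.Finite}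
  zero_mem' := by simp
  add_mem' := by
    intro φ ψ hφ hψ
    refine (hφ.union hψ).subset fun p hp => ?_
    by_contra h
    simp only [Set.mem_union, Set.mem_ofPred_eq, not_or, not_not] at h
    exact hp (by simp [h.1, h.2])
  neg_mem' := by
    intro φ hφ
    simpa using hφ

theorem δ_mem_bdd (n m : ℤ) {φ : Hyp PA PB n} (hφ : φ ∈ bdd PA PB n) :
    δ n m φ ∈ bdd PA PB m := by
  by_cases hnm : n + 1 = m
  · refine (hφ.union (hφ.preimage (add_left_injective (1 : ℤ)).injOn)).subset fun p hp => ?_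
    by_contra h
    simp only [Set.mem_union, Set.mem_preimage, Set.mem_ofPred_eq, not_or, not_not] at h
    refine hp ?_
    subst hnm
    have h2 : φ.v (p + 1) (p + (n + 1)) (by omega) = 0 := by
      have key : ∀ q (hq : p + 1 + n = q), φ.v (p + 1) q hq = 0 := by
        rintro _ rfl
        exact h.2
      exact key _ _
    rw [δ_v n (n + 1) rfl φ p _ rfl (p + n) (p + 1) (by omega) rfl, h.1, h2]
    simp
  · rw [δ_shape n m hnm]
    exact zero_mem _

/-- The `n`-cochains of the Vogel complex, the quotient of the hypercohomology complex by the
bounded subcomplex. -/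
abbrev Vog (n : ℤ) : Type v := Hyp PA PB n ⧸ bdd PA PB n

/-- The differential of the Vogel complex. -/
def vogD (n m : ℤ) : Vog PA PB n →+ Vog PA PB m :=
  QuotientAddGroup.map (bdd PA PB n) (bdd PA PB m)
    (δ_hom ℤ PA.cochainComplex PB.cochainComplex n m).toAddMonoidHom
    (fun _ hφ => δ_mem_bdd PA PB n m hφ)

/-- The hypercohomology construction of the `n`-th completed Ext group: the `n`-th cohomology group
of the Vogel complex, that is, kernel modulo image. -/
abbrev VogelExt (n : ℤ) : Type v :=
  (vogD PA PB n (n + 1)).ker ⧸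
    (vogD PA PB (n - 1) n).range.addSubgroupOf (vogD PA PB n (n + 1)).ker

variable {PA PB}

/-- Almost chain maps of degree `n`: families `PA_{n+k} ⟶ PB_k` that commute with the differentials,
up to the sign `(-1) ^ n`, in all but finitely many degrees. -/
def IsAlmostChainMap {n : ℤ} (φ : Hyp PA PB n) : Prop := δ n (n + 1) φ ∈ bdd PA PB (n + 1)

/-- The element of the completed Ext group which is represented by an almost chain map. -/
def vogelMk {n : ℤ} (φ : Hyp PA PB n) (hφ : IsAlmostChainMap φ) : VogelExt PA PB n :=
  QuotientAddGroup.mk ⟨QuotientAddGroup.mk φ, (QuotientAddGroup.eq_zero_iff _).2 hφ⟩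

/-- The family `φ` commutes with the differentials, up to the sign `(-1) ^ n`, in all degrees
`k ≥ K`; that is, all members `PA_{n+1+k} ⟶ PB_k` of its coboundary with `k ≥ K` vanish. -/
def IsChainMapFrom {n : ℤ} (φ : Hyp PA PB n) (K : ℕ) : Prop :=
  ∀ (p q : ℤ) (hpq : p + (n + 1) = q), q ≤ -(K : ℤ) → (δ n (n + 1) φ).v p q hpq = 0

/-- The member `PA_i ⟶ PB_k`, `i = n + k`, of a family `φ`. -/
def component {n : ℤ} (φ : Hyp PA PB n) (i k : ℕ) (h : (i : ℤ) = n + k) :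
    PA.complex.X i ⟶ PB.complex.X k :=
  (PA.cochainComplexXIso (-(i : ℤ)) i rfl).inv ≫ φ.v (-(i : ℤ)) (-(k : ℤ)) (by omega) ≫
    (PB.cochainComplexXIso (-(k : ℤ)) k rfl).hom

end Vogel

/-- The sign `(-1) ^ (n (n - 1) / 2 + n k)` by which the members of an almost chain map of degree
`n` are normalised: the resolutions shifted by `n` have their differential multiplied by
`(-1) ^ n`. -/
def stageSign (n : ℤ) (k : ℕ) : ℤˣ := Int.negOnePow (n * (n - 1) / 2 + n * k)

end CompletedExt

end

noncomputable section

namespace CompletedExt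

variable {C : Type u} [Category.{v} C] [Abelian C] {A B D : C}
  {PA : ProjectiveResolution A} {PB : ProjectiveResolution B} {PD : ProjectiveResolution D}

/-! ## Components of cochains -/

/-! For large `k` an almost chain map satisfies `b φ_{k+1} = (-1)^n φ_k a`, so `φ_k` descends to a
morphism of syzygies. Since `φ_k` is itself a lift of that morphism, the transition map sends its
class to `(-1)^n` times the class induced by `φ_{k+1}`. The factor `stageSign n k` absorbs this
sign, so the signed class has the same image in the direct limit for all large `k`. This defines
`toNaive` on the group of almost chain maps, which also projects onto `VogelExt` by `toVogel`. Both
maps are surjective and have the same kernel, and `comparison` is the resulting isomorphism of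
quotients.

Surjectivity of `toNaive`: a morphism of syzygies is lifted and continued upwards by projectivity;
the members below the starting stage are set to zero. Kernels: if `φ` is a coboundary up to bounded
terms, then at high stages the induced morphism factors through a projective term of the resolution
(`toNaive_eq_zero_of_sub_mem_bdd`). Conversely, a factorisation through a projective at one stage
gives the first member of a homotopy, and exactness supplies all later members
(`exists_sub_mem_bdd_of_toNaive_eq_zero`). Both recursions are instances of
`exists_cochain_of_step`.

The naïve product is computed at any common stage; it is well defined because composition commutes
with the transition maps (`transition_stableComp`). Induced morphisms compose, and the signs
multiply correctly by `stageSign_add`. The hypercohomology product is the naïve one transported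
along `comparison`, and `comparison_vogelMk_comp` identifies it with composition of representatives.
-/

theorem v_eq_component {n : ℤ} (φ : Hyp PA PB n) (i k : ℕ) (h : (i : ℤ) = n + k) (p q : ℤ)
    (hpq : p + n = q) (hp : -(i : ℤ) = p) (hq : -(k : ℤ) = q) :
    φ.v p q hpq = (PA.cochainComplexXIso p i hp).hom ≫ component φ i k h ≫
      (PB.cochainComplexXIso q k hq).inv := by
  subst hp hq
  simp [component]

theorem v_eq_zero_of_pos {n : ℤ} (φ : Hyp PA PB n) (p q : ℤ) (hpq : p + n = q)
    (h : 0 < p ∨ 0 < q) : φ.v p q hpq = 0 := by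
  rcases h with h | h
  · exact (CochainComplex.isZero_of_isStrictlyLE PA.cochainComplex 0 p h).eq_of_src _ _
  · exact (CochainComplex.isZero_of_isStrictlyLE PB.cochainComplex 0 q h).eq_of_tgt _ _

theorem v_eq_zero_iff {n : ℤ} (φ : Hyp PA PB n) (i k : ℕ) (h : (i : ℤ) = n + k) (p q : ℤ)
    (hpq : p + n = q) (hp : -(i : ℤ) = p) (hq : -(k : ℤ) = q) :
    φ.v p q hpq = 0 ↔ component φ i k h = 0 := by
  rw [v_eq_component φ i k h p q hpq hp hq]
  simp

theorem component_add {n : ℤ} (φ ψ : Hyp PA PB n) (i k : ℕ) (h : (i : ℤ) = n + k) :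
    component (φ + ψ) i k h = component φ i k h + component ψ i k h := by
  simp [component]

theorem component_sub {n : ℤ} (φ ψ : Hyp PA PB n) (i k : ℕ) (h : (i : ℤ) = n + k) :
    component (φ - ψ) i k h = component φ i k h - component ψ i k h := by
  simp [component]

theorem component_comp {m n : ℤ} (f : Hyp PA PB m) (g : Hyp PB PD n) (i j k : ℕ)
    (hjk : (j : ℤ) = n + k) (hij : (i : ℤ) = m + j) (hik : (i : ℤ) = m + n + k) :
    component (f.comp g rfl) i k hik = component f i j hij ≫ component g j k hjk := by
  simp [component, Cochain.comp_v f g rfl (-(i : ℤ)) (-(j : ℤ)) (-(k : ℤ)) (by omega) (by omega)]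

theorem component_δ {n : ℤ} (φ : Hyp PA PB n) (i k : ℕ) (h : (i : ℤ) = n + k) (m : ℤ)
    (hm : n + 1 = m) :
    component (δ n m φ) (i + 1) k (by omega) =
      component φ (i + 1) (k + 1) (by omega) ≫ PB.complex.d (k + 1) k +
        m.negOnePow • PA.complex.d (i + 1) i ≫ component φ i k h := by
  rw [component, δ_v n m hm φ _ _ (by omega) (-((k + 1 : ℕ) : ℤ)) (-(i : ℤ)) (by omega) (by omega),
    v_eq_component φ (i + 1) (k + 1) (by omega) _ _ (by omega) rfl rfl,
    v_eq_component φ i k h _ _ (by omega) rfl rfl,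
    PA.cochainComplex_d _ _ (i + 1) i rfl rfl, PB.cochainComplex_d _ _ (k + 1) k rfl rfl]
  simp

/-- The cochain with prescribed components. -/
def ofComponents {n : ℤ}
    (g : ∀ (i k : ℕ), (i : ℤ) = n + k → (PA.complex.X i ⟶ PB.complex.X k)) : Hyp PA PB n :=
  Cochain.mk fun p q hpq =>
    if hp : p ≤ 0 ∧ q ≤ 0 then
      (PA.cochainComplexXIso p (-p).toNat (by omega)).hom ≫
        g (-p).toNat (-q).toNat (by omega) ≫ (PB.cochainComplexXIso q (-q).toNat (by omega)).inv
    -- In these degrees one of the resolutions vanishes, so zero is the only possible value.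
    else 0

@[simp]
theorem component_ofComponents {n : ℤ}
    (g : ∀ (i k : ℕ), (i : ℤ) = n + k → (PA.complex.X i ⟶ PB.complex.X k))
    (i k : ℕ) (h : (i : ℤ) = n + k) : component (ofComponents g) i k h = g i k h := by
  -- The indices produced by `toNat` equal `i` and `k` only propositionally; they are generalised so
  -- that they can be substituted.
  have key : ∀ (i' k' : ℕ) (hi : i' = i) (hk : k' = k),
      (PA.cochainComplexXIso (-(i : ℤ)) i rfl).inv ≫
        ((PA.cochainComplexXIso (-(i : ℤ)) i' (by omega)).hom ≫ g i' k' (by omega) ≫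
          (PB.cochainComplexXIso (-(k : ℤ)) k' (by omega)).inv) ≫
        (PB.cochainComplexXIso (-(k : ℤ)) k rfl).hom = g i k h := by
    rintro i' k' rfl rfl
    simp
  rw [component, ofComponents, Cochain.mk_v, dif_pos (by omega)]
  exact key _ _ (by omega) (by omega)

/-! ### Bounded families and almost chain maps in terms of components. -/

theorem mem_bdd_iff {n : ℤ} (φ : Hyp PA PB n) :
    φ ∈ bdd PA PB n ↔
      ∃ N : ℕ, ∀ (i k : ℕ) (h : (i : ℤ) = n + k), N ≤ k → component φ i k h = 0 := by
  constructor
  · intro hφ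
    obtain ⟨b, hb⟩ := hφ.bddBelow
    -- A nonzero component with source index `i` has `b ≤ -i`, hence `k = i - n ≤ -b + |n|`.
    refine ⟨(-b + |n|).toNat + 1, fun i k h hk => ?_⟩
    by_contra hne
    have := hb (a := -(i : ℤ)) fun h0 => hne
      ((v_eq_zero_iff φ i k h _ _ _ rfl (by omega)).1 h0)
    have := neg_abs_le n
    have := le_abs_self n
    omega
  · rintro ⟨N, hN⟩
    -- Positive degrees contribute nothing, and `p = -(n + k)` lies below the interval only if `k >
    -- N`.
    refine (Set.finite_Icc (-(n + N)) 0).subset fun p hp => ?_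
    by_contra hmem
    refine hp ?_
    by_cases hpos : 0 < p ∨ 0 < p + n
    · exact v_eq_zero_of_pos _ _ _ _ hpos
    · have hmem' : ¬ (-(n + N) ≤ p ∧ p ≤ 0) := hmem
      rw [v_eq_zero_iff φ (-p).toNat (-(p + n)).toNat (by omega) _ _ rfl (by omega) (by omega)]
      exact hN _ _ _ (by omega)

theorem isChainMapFrom_iff {n : ℤ} (φ : Hyp PA PB n) (K : ℕ) :
    IsChainMapFrom φ K ↔ ∀ (i k : ℕ) (h : (i : ℤ) = n + 1 + k), K ≤ k →
      component (δ n (n + 1) φ) i k h = 0 := by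
  constructor
  · intro hφ i k h hk
    exact (v_eq_zero_iff _ i k h _ _ (by omega) rfl rfl).1 (hφ _ _ _ (by omega))
  · intro hφ p q hpq hq
    by_cases hpos : 0 < p
    · exact v_eq_zero_of_pos _ _ _ _ (Or.inl hpos)
    · exact (v_eq_zero_iff _ (-p).toNat (-q).toNat (by omega) _ _ _ (by omega) (by omega)).2
        (hφ _ _ _ (by omega))

theorem isAlmostChainMap_iff {n : ℤ} (φ : Hyp PA PB n) :
    IsAlmostChainMap φ ↔ ∃ K : ℕ, IsChainMapFrom φ K := by
  simp only [isChainMapFrom_iff]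
  exact mem_bdd_iff _

theorem IsChainMapFrom.component_comp_d {n : ℤ} {φ : Hyp PA PB n} {K : ℕ}
    (hφ : IsChainMapFrom φ K) (i k : ℕ) (h : (i : ℤ) = n + k) (hk : K ≤ k) :
    component φ (i + 1) (k + 1) (by omega) ≫ PB.complex.d (k + 1) k =
      n.negOnePow • PA.complex.d (i + 1) i ≫ component φ i k h := by
  have := (isChainMapFrom_iff φ K).1 hφ (i + 1) k (by omega) hk
  rw [component_δ φ i k h _ rfl, Int.negOnePow_succ] at this
  simpa [add_neg_eq_zero] using this

theorem isAlmostChainMap_comp {m n : ℤ} {f : Hyp PA PB m} {g : Hyp PB PD n}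
    (hf : IsAlmostChainMap f) (hg : IsAlmostChainMap g) :
    IsAlmostChainMap (f.comp g rfl) := by
  rw [isAlmostChainMap_iff] at hf hg ⊢
  obtain ⟨K, hK⟩ := hf
  obtain ⟨L, hL⟩ := hg
  -- Beyond this bound `k ≥ L`, the middle index `j = n + k` is a natural number with `j ≥ K`, and
  -- the source index is positive, as `component_δ` requires.
  refine ⟨K + L + n.natAbs + m.natAbs + 1, (isChainMapFrom_iff _ _).2 fun i k h hk => ?_⟩
  obtain ⟨j, hj⟩ : ∃ j : ℕ, (j : ℤ) = n + k := ⟨(n + k).toNat, by omega⟩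
  obtain ⟨i, rfl⟩ : ∃ i' : ℕ, i = i' + 1 := ⟨i - 1, by omega⟩
  rw [component_δ _ i k (by omega) _ rfl, component_comp f g i j k hj (by omega) (by omega),
    component_comp f g (i + 1) (j + 1) (k + 1) (by omega) (by omega) (by omega), Category.assoc,
    hL.component_comp_d j k hj (by omega), Linear.comp_units_smul, ← Category.assoc,
    hK.component_comp_d i j (by omega) (by omega), Linear.units_smul_comp, smul_smul,
    Int.negOnePow_succ, Int.negOnePow_add, mul_comm]
  simp

/-! ## The direct system of stable Hom groups -/

theorem stageIndex_le_iff {n : ℤ} {p q : StageIndex n} : p ≤ q ↔ p.1.2 ≤ q.1.2 := by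
  refine ⟨fun h => h.2, fun h => ⟨?_, h⟩⟩
  have := p.2
  have := q.2
  change p.1.1 ≤ q.1.1
  omega

instance (n : ℤ) : Nonempty (StageIndex n) :=
  ⟨⟨((n + n.natAbs).toNat, n.natAbs), by dsimp only; omega⟩⟩

instance (n : ℤ) : IsDirectedOrder (StageIndex n) where
  directed p q := by
    rcases le_total p.1.2 q.1.2 with h | h
    · exact ⟨q, stageIndex_le_iff.2 h, le_rfl⟩
    · exact ⟨p, le_rfl, stageIndex_le_iff.2 h⟩

theorem naiveOf_transition {n : ℤ} {i k i' k' : ℕ} (h : (i : ℤ) = n + k) (j : ℕ)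
    (hi : i + j = i') (hk : k + j = k') (h' : (i' : ℤ) = n + k')
    (x : StableHom (syz PA i) (syz PB k)) :
    naiveOf PA PB n i' k' h' (transition PA PB j hi hk x) = naiveOf PA PB n i k h x := by
  obtain rfl : j = k' - k := by omega
  exact AddCommGroup.DirectLimit.of_f (f := naiveMap PA PB n) (i := ⟨(i, k), h⟩)
    (j := ⟨(i', k'), h'⟩) (stageIndex_le_iff.2 (by dsimp only; omega)) x

theorem naiveOf_stableNext {n : ℤ} {i k : ℕ} (h : (i : ℤ) = n + k)
    (h' : ((i + 1 : ℕ) : ℤ) = n + (k + 1 : ℕ)) (x : StableHom (syz PA i) (syz PB k)) :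
    naiveOf PA PB n (i + 1) (k + 1) h' (stableNext PA PB i k x) = naiveOf PA PB n i k h x :=
  naiveOf_transition h 1 rfl rfl h' x

theorem exists_naiveOf {n : ℤ} (z : NaiveExt PA PB n) :
    ∃ (i k : ℕ) (h : (i : ℤ) = n + k) (x : StableHom (syz PA i) (syz PB k)),
      naiveOf PA PB n i k h x = z := by
  induction z using AddCommGroup.DirectLimit.induction_on with
  | ih p x => exact ⟨p.1.1, p.1.2, p.2, x, rfl⟩

theorem exists_naiveOf_of_le {n : ℤ} (z : NaiveExt PA PB n) :
    ∃ N : ℕ, ∀ (i k : ℕ) (h : (i : ℤ) = n + k), N ≤ k →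
      ∃ x : StableHom (syz PA i) (syz PB k), naiveOf PA PB n i k h x = z := by
  obtain ⟨i, k, h, x, rfl⟩ := exists_naiveOf z
  exact ⟨k, fun i' k' h' hk => ⟨transition PA PB (k' - k) (by omega) (by omega) x,
    naiveOf_transition _ _ _ _ _ _⟩⟩

theorem exists_transition_eq_zero {n : ℤ} {i k : ℕ} (h : (i : ℤ) = n + k)
    {x : StableHom (syz PA i) (syz PB k)} (hx : naiveOf PA PB n i k h x = 0) :
    ∃ j : ℕ, transition PA PB j rfl rfl x = 0 := by
  obtain ⟨⟨⟨i', k'⟩, h'⟩, hle, h0⟩ := AddCommGroup.DirectLimit.of.zero_exact _ _ hx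
  have hk : k ≤ k' := hle.2
  dsimp only at h'
  obtain ⟨j, rfl⟩ := Nat.exists_eq_add_of_le hk
  obtain rfl : i' = i + j := by omega
  refine ⟨j, ?_⟩
  have hj : k + j - k = j := by omega
  change transition PA PB (k + j - k) _ _ x = 0 at h0
  -- `naiveMap` iterates `k + j - k` times; the exponent is generalised so that it can be replaced
  -- by `j`.
  have key : ∀ (l : ℕ) (hi : i + l = i + j) (hk : k + l = k + j),
      transition PA PB l hi hk x = 0 → transition PA PB j rfl rfl x = 0 := by
    intro l hi hk hl
    obtain rfl : l = j := by omega
    exact hl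
  exact key _ _ _ h0

/-! ## The composition product on the direct limits -/

/-- A composite of lifts is a lift of the composite, and the transition map may be computed with any
lift. -/
theorem stableNext_stableComp {i j k : ℕ} (y : StableHom (syz PB j) (syz PD k))
    (x : StableHom (syz PA i) (syz PB j)) :
    stableNext PA PD i k (stableComp _ _ _ y x) =
      stableComp _ _ _ (stableNext PB PD j k y) (stableNext PA PB i j x) := by
  obtain ⟨g, rfl⟩ := QuotientAddGroup.mk'_surjective _ y
  obtain ⟨f, rfl⟩ := QuotientAddGroup.mk'_surjective _ x
  change stableNext PA PD i k (stableMk (f ≫ g)) =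
    stableComp _ _ _ (stableMk (nextMap PB PD g)) (stableMk (nextMap PA PB f))
  rw [stableComp_mk]
  refine stableNext_mk PA PD (g := liftMap PA PB f ≫ liftMap PB PD g) ?_ ?_
  · rw [Category.assoc, liftMap_syzπ, ← Category.assoc, liftMap_syzπ, Category.assoc]
  · rw [Category.assoc, nextMap_syzι, ← Category.assoc, nextMap_syzι, Category.assoc]

theorem transition_stableComp {i j k : ℕ} (y : StableHom (syz PB j) (syz PD k))
    (x : StableHom (syz PA i) (syz PB j)) (l : ℕ) :
    transition PA PD l rfl rfl (stableComp _ _ _ y x) =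
      stableComp _ _ _ (transition PB PD l rfl rfl y) (transition PA PB l rfl rfl x) := by
  induction l with
  | zero => rfl
  | succ l ih =>
    rw [transition_succ PA PD l rfl rfl rfl rfl, ih, stableNext_stableComp,
      transition_succ PB PD l rfl rfl rfl rfl, transition_succ PA PB l rfl rfl rfl rfl]
    rfl

/-- `z` is the composition product of `y` and `x`, computed at some common stage. -/
def IsNaiveComp {m n : ℤ} (y : NaiveExt PB PD n) (x : NaiveExt PA PB m)
    (z : NaiveExt PA PD (m + n)) : Prop :=
  ∃ (i j k : ℕ) (hjk : (j : ℤ) = n + k) (hij : (i : ℤ) = m + j) (hik : (i : ℤ) = m + n + k)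
    (y' : StableHom (syz PB j) (syz PD k)) (x' : StableHom (syz PA i) (syz PB j)),
    naiveOf PB PD n j k hjk y' = y ∧ naiveOf PA PB m i j hij x' = x ∧
      naiveOf PA PD (m + n) i k hik (stableComp _ _ _ y' x') = z

/-- Transition maps carry a witness to every later stage. This allows two witnesses to be compared
at the same stage. -/
theorem IsNaiveComp.exists_stage {m n : ℤ} {y : NaiveExt PB PD n} {x : NaiveExt PA PB m}
    {z : NaiveExt PA PD (m + n)} (hz : IsNaiveComp y x z) :
    ∃ N : ℕ, ∀ (i j k : ℕ) (hjk : (j : ℤ) = n + k) (hij : (i : ℤ) = m + j)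
      (hik : (i : ℤ) = m + n + k), N ≤ k →
      ∃ (y' : StableHom (syz PB j) (syz PD k)) (x' : StableHom (syz PA i) (syz PB j)),
        naiveOf PB PD n j k hjk y' = y ∧ naiveOf PA PB m i j hij x' = x ∧
          naiveOf PA PD (m + n) i k hik (stableComp _ _ _ y' x') = z := by
  obtain ⟨i, j, k, hjk, hij, hik, y', x', rfl, rfl, rfl⟩ := hz
  refine ⟨k, fun i₁ j₁ k₁ h₁ h₂ h₃ hk => ?_⟩
  obtain ⟨l, rfl⟩ := Nat.exists_eq_add_of_le hk
  obtain rfl : j₁ = j + l := by omega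
  obtain rfl : i₁ = i + l := by omega
  refine ⟨transition PB PD l rfl rfl y', transition PA PB l rfl rfl x',
    naiveOf_transition _ _ _ _ _ _, naiveOf_transition _ _ _ _ _ _, ?_⟩
  rw [← transition_stableComp]
  exact naiveOf_transition _ _ _ _ _ _

/-- Adding `|m| + |n|` to `N` keeps all three indices above `N`. With one degree equal to zero the
lemma also supplies a single late stage. -/
theorem exists_common_stage (m n : ℤ) (N : ℕ) : ∃ i j k : ℕ,
    (j : ℤ) = n + k ∧ (i : ℤ) = m + j ∧ (i : ℤ) = m + n + k ∧ N ≤ k ∧ N ≤ j ∧ N ≤ i := by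
  refine ⟨(m + n + (N + m.natAbs + n.natAbs)).toNat, (n + (N + m.natAbs + n.natAbs)).toNat,
    N + m.natAbs + n.natAbs, ?_, ?_, ?_, ?_, ?_, ?_⟩ <;> omega

theorem exists_isNaiveComp {m n : ℤ} (y : NaiveExt PB PD n) (x : NaiveExt PA PB m) :
    ∃ z, IsNaiveComp y x z := by
  obtain ⟨N, hN⟩ := exists_naiveOf_of_le y
  obtain ⟨M, hM⟩ := exists_naiveOf_of_le x
  obtain ⟨i, j, k, hjk, hij, hik, hk, hj, -⟩ := exists_common_stage m n (N + M)
  obtain ⟨y', rfl⟩ := hN j k hjk (by omega)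
  obtain ⟨x', rfl⟩ := hM i j hij (by omega)
  exact ⟨_, i, j, k, hjk, hij, hik, y', x', rfl, rfl, rfl⟩

theorem naiveOf_stableComp_eq_zero_left {m n : ℤ} {i j k : ℕ} (hjk : (j : ℤ) = n + k)
    (hik : (i : ℤ) = m + n + k)
    (y : StableHom (syz PB j) (syz PD k)) (x : StableHom (syz PA i) (syz PB j))
    (hy : naiveOf PB PD n j k hjk y = 0) :
    naiveOf PA PD (m + n) i k hik (stableComp _ _ _ y x) = 0 := by
  obtain ⟨l, hl⟩ := exists_transition_eq_zero hjk hy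
  rw [← naiveOf_transition hik l rfl rfl (by omega), transition_stableComp, hl, map_zero,
    AddMonoidHom.zero_apply, map_zero]

theorem naiveOf_stableComp_eq_zero_right {m n : ℤ} {i j k : ℕ} (hij : (i : ℤ) = m + j)
    (hik : (i : ℤ) = m + n + k)
    (y : StableHom (syz PB j) (syz PD k)) (x : StableHom (syz PA i) (syz PB j))
    (hx : naiveOf PA PB m i j hij x = 0) :
    naiveOf PA PD (m + n) i k hik (stableComp _ _ _ y x) = 0 := by
  obtain ⟨l, hl⟩ := exists_transition_eq_zero hij hx
  rw [← naiveOf_transition hik l rfl rfl (by omega), transition_stableComp, hl, map_zero, map_zero]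

theorem IsNaiveComp.unique {m n : ℤ} {y : NaiveExt PB PD n} {x : NaiveExt PA PB m}
    {z z' : NaiveExt PA PD (m + n)} (hz : IsNaiveComp y x z) (hz' : IsNaiveComp y x z') :
    z = z' := by
  obtain ⟨N, hN⟩ := hz.exists_stage
  obtain ⟨M, hM⟩ := hz'.exists_stage
  obtain ⟨i, j, k, hjk, hij, hik, hk, -, -⟩ := exists_common_stage m n (N + M)
  obtain ⟨y₁, x₁, rfl, rfl, rfl⟩ := hN i j k hjk hij hik (by omega)
  obtain ⟨y₂, x₂, hy, hx, rfl⟩ := hM i j k hjk hij hik (by omega)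
  -- Both halves of `y₁x₁ - y₂x₂ = (y₁ - y₂)x₁ + y₂(x₁ - x₂)` vanish in the limit.
  have h₁ := naiveOf_stableComp_eq_zero_left hjk hik (y₁ - y₂) x₁ (by rw [map_sub, hy, sub_self])
  have h₂ := naiveOf_stableComp_eq_zero_right hij hik y₂ (x₁ - x₂) (by rw [map_sub, hx, sub_self])
  rw [map_sub, AddMonoidHom.sub_apply, map_sub, sub_eq_zero] at h₁
  rw [map_sub, map_sub, sub_eq_zero] at h₂
  exact h₁.trans h₂

theorem IsNaiveComp.add_left {m n : ℤ} {y₁ y₂ : NaiveExt PB PD n} {x : NaiveExt PA PB m}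
    {z₁ z₂ : NaiveExt PA PD (m + n)} (h₁ : IsNaiveComp y₁ x z₁) (h₂ : IsNaiveComp y₂ x z₂) :
    IsNaiveComp (y₁ + y₂) x (z₁ + z₂) := by
  obtain ⟨N, hN⟩ := h₁.exists_stage
  obtain ⟨M, hM⟩ := exists_naiveOf_of_le y₂
  obtain ⟨i, j, k, hjk, hij, hik, hk, -, -⟩ := exists_common_stage m n (N + M)
  obtain ⟨y₁, x, rfl, rfl, rfl⟩ := hN i j k hjk hij hik (by omega)
  obtain ⟨y₂, rfl⟩ := hM j k hjk (by omega)
  refine ⟨i, j, k, hjk, hij, hik, y₁ + y₂, x, map_add _ _ _, rfl, ?_⟩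
  rw [map_add, AddMonoidHom.add_apply, map_add]
  -- The witness of `h₂` may use another representative of the class of `x`; uniqueness removes the
  -- difference.
  exact congrArg _ (IsNaiveComp.unique ⟨i, j, k, hjk, hij, hik, y₂, x, rfl, rfl, rfl⟩ h₂)

theorem IsNaiveComp.add_right {m n : ℤ} {y : NaiveExt PB PD n} {x₁ x₂ : NaiveExt PA PB m}
    {z₁ z₂ : NaiveExt PA PD (m + n)} (h₁ : IsNaiveComp y x₁ z₁) (h₂ : IsNaiveComp y x₂ z₂) :
    IsNaiveComp y (x₁ + x₂) (z₁ + z₂) := by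
  obtain ⟨N, hN⟩ := h₁.exists_stage
  obtain ⟨M, hM⟩ := exists_naiveOf_of_le x₂
  obtain ⟨i, j, k, hjk, hij, hik, hk, hj, -⟩ := exists_common_stage m n (N + M)
  obtain ⟨y, x₁, rfl, rfl, rfl⟩ := hN i j k hjk hij hik (by omega)
  obtain ⟨x₂, rfl⟩ := hM i j hij (by omega)
  refine ⟨i, j, k, hjk, hij, hik, y, x₁ + x₂, rfl, map_add _ _ _, ?_⟩
  rw [map_add, map_add]
  exact congrArg _ (IsNaiveComp.unique ⟨i, j, k, hjk, hij, hik, y, x₂, rfl, rfl, rfl⟩ h₂)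

/-- The composition product of the naïve construction, as a biadditive map. -/
def naiveComp (PA : ProjectiveResolution A) (PB : ProjectiveResolution B)
    (PD : ProjectiveResolution D) (m n : ℤ) :
    NaiveExt PB PD n →+ NaiveExt PA PB m →+ NaiveExt PA PD (m + n) :=
  AddMonoidHom.mk'
    (fun y => AddMonoidHom.mk' (fun x => (exists_isNaiveComp y x).choose) fun x₁ x₂ =>
      (exists_isNaiveComp y (x₁ + x₂)).choose_spec.unique
        ((exists_isNaiveComp y x₁).choose_spec.add_right (exists_isNaiveComp y x₂).choose_spec))
    (fun y₁ y₂ => AddMonoidHom.ext fun x =>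
      (exists_isNaiveComp (y₁ + y₂) x).choose_spec.unique
        ((exists_isNaiveComp y₁ x).choose_spec.add_left (exists_isNaiveComp y₂ x).choose_spec))

theorem naiveComp_naiveOf {m n : ℤ} {i j k : ℕ} (hjk : (j : ℤ) = n + k) (hij : (i : ℤ) = m + j)
    (hik : (i : ℤ) = m + n + k)
    (y : StableHom (syz PB j) (syz PD k)) (x : StableHom (syz PA i) (syz PB j)) :
    naiveComp PA PB PD m n (naiveOf PB PD n j k hjk y) (naiveOf PA PB m i j hij x) =
      naiveOf PA PD (m + n) i k hik (stableComp _ _ _ y x) :=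
  (exists_isNaiveComp _ _).choose_spec.unique ⟨i, j, k, hjk, hij, hik, y, x, rfl, rfl, rfl⟩

/-- The composition product of the naïve construction on the tensor product. -/
def naiveProd (PA : ProjectiveResolution A) (PB : ProjectiveResolution B)
    (PD : ProjectiveResolution D) (m n : ℤ) :
    NaiveExt PB PD n ⊗[ℤ] NaiveExt PA PB m →+ NaiveExt PA PD (m + n) :=
  TensorProduct.liftAddHom (naiveComp PA PB PD m n) fun r y x => by
    rw [map_zsmul, map_zsmul, AddMonoidHom.zsmul_apply]

@[simp]
theorem naiveProd_tmul {m n : ℤ} (y : NaiveExt PB PD n) (x : NaiveExt PA PB m) :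
    naiveProd PA PB PD m n (y ⊗ₜ[ℤ] x) = naiveComp PA PB PD m n y x := rfl

/-! ## Morphisms between syzygies induced by almost chain maps -/

theorem units_smul_add {G : Type*} [AddCommGroup G] (a : ℤˣ) (x y : G) :
    a • (x + y) = a • x + a • y :=
  smul_add a x y

theorem units_smul_eq_zero {G : Type*} [AddCommGroup G] {a : ℤˣ} {x : G} : a • x = 0 ↔ x = 0 :=
  smul_eq_zero_iff_eq a

theorem map_units_smul {G G' : Type*} [AddCommGroup G] [AddCommGroup G'] (f : G →+ G') (a : ℤˣ)
    (x : G) : f (a • x) = a • f x := by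
  rw [Units.smul_def, Units.smul_def, map_zsmul]

@[simp]
theorem syzπ_syzι (P : ProjectiveResolution A) (k : ℕ) :
    syzπ P (k + 1) ≫ syzι P k = P.complex.d (k + 1) k :=
  kernel.lift_ι _ _ _

@[simp]
theorem d_syzπ (P : ProjectiveResolution A) (k : ℕ) : P.complex.d (k + 1) k ≫ syzπ P k = 0 :=
  (syzygyStage P k).w

@[simp]
theorem d_syzπ_assoc (P : ProjectiveResolution A) (k : ℕ) {X : C} (f : syz P k ⟶ X) :
    P.complex.d (k + 1) k ≫ syzπ P k ≫ f = 0 := by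
  rw [← Category.assoc, d_syzπ, zero_comp]

theorem exists_desc_syz (P : ProjectiveResolution A) (k : ℕ) {X : C} (g : P.complex.X k ⟶ X)
    (hg : P.complex.d (k + 1) k ≫ g = 0) : ∃ f : syz P k ⟶ X, g = syzπ P k ≫ f := by
  have := (syzygyStage P k).epi
  exact ⟨(syzygyStage P k).exact.desc g hg, ((syzygyStage P k).exact.g_desc g hg).symm⟩

/-- Such a morphism lands in the next syzygy, and projectivity of `X` lifts it along the epimorphism
onto that syzygy. This drives the recursive construction of homotopies. -/
theorem exists_lift_d (P : ProjectiveResolution A) (k : ℕ) {X : C} [Projective X]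
    (g : X ⟶ P.complex.X k) (hg : g ≫ syzπ P k = 0) :
    ∃ l : X ⟶ P.complex.X (k + 1), l ≫ P.complex.d (k + 1) k = g :=
  ⟨Projective.factorThru (syzLift P k g hg) (syzπ P (k + 1)), by
    rw [← syzπ_syzι, ← Category.assoc, Projective.factorThru_comp, syzLift_syzι]⟩

/-- The member `PA_i ⟶ PB_k` of the family `φ` induces the morphism `f` between the syzygies. -/
def Induces {n : ℤ} (φ : Hyp PA PB n) (i k : ℕ) (h : (i : ℤ) = n + k)
    (f : syz PA i ⟶ syz PB k) : Prop :=
  component φ i k h ≫ syzπ PB k = syzπ PA i ≫ f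

theorem Induces.unique {n : ℤ} {φ : Hyp PA PB n} {i k : ℕ} {h : (i : ℤ) = n + k}
    {f f' : syz PA i ⟶ syz PB k} (hf : Induces φ i k h f) (hf' : Induces φ i k h f') : f = f' := by
  rw [← cancel_epi (syzπ PA i)]
  exact hf.symm.trans hf'

theorem Induces.add {n : ℤ} {φ ψ : Hyp PA PB n} {i k : ℕ} {h : (i : ℤ) = n + k}
    {f g : syz PA i ⟶ syz PB k} (hf : Induces φ i k h f) (hg : Induces ψ i k h g) :
    Induces (φ + ψ) i k h (f + g) := by
  rw [Induces] at *
  rw [component_add, Preadditive.add_comp, Preadditive.comp_add, hf, hg]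

theorem Induces.comp {m n : ℤ} {φ : Hyp PA PB m} {ψ : Hyp PB PD n} {i j k : ℕ}
    {hij : (i : ℤ) = m + j} {hjk : (j : ℤ) = n + k} {f : syz PA i ⟶ syz PB j}
    {g : syz PB j ⟶ syz PD k} (hf : Induces φ i j hij f) (hg : Induces ψ j k hjk g)
    (hik : (i : ℤ) = m + n + k) : Induces (φ.comp ψ rfl) i k hik (f ≫ g) := by
  rw [Induces] at *
  rw [component_comp φ ψ i j k hjk hij hik, Category.assoc, hg, ← Category.assoc, hf,
    Category.assoc]

/-- The syzygy is the cokernel of the differential, and `φ_k a = ± b φ_{k+1}` is killed by the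
projection. -/
theorem IsChainMapFrom.exists_induces {n : ℤ} {φ : Hyp PA PB n} {K : ℕ}
    (hφ : IsChainMapFrom φ K) (i k : ℕ) (h : (i : ℤ) = n + k) (hk : K ≤ k) :
    ∃ f, Induces φ i k h f := by
  refine exists_desc_syz PA i _ ?_
  have h0 : (n.negOnePow • PA.complex.d (i + 1) i ≫ component φ i k h) ≫ syzπ PB k = 0 := by
    rw [← hφ.component_comp_d i k h hk, Category.assoc, d_syzπ, comp_zero]
  rwa [Linear.units_smul_comp, smul_eq_zero_iff_eq, Category.assoc] at h0

/-- The member `φ_k` is a lift of `f`, so the transition can be computed with it; the sign is that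
of the commutation relation. -/
theorem IsChainMapFrom.stableNext_stableMk {n : ℤ} {φ : Hyp PA PB n} {K : ℕ}
    (hφ : IsChainMapFrom φ K) {i k : ℕ} {h : (i : ℤ) = n + k} (hk : K ≤ k)
    {h' : ((i + 1 : ℕ) : ℤ) = n + (k + 1 : ℕ)}
    {f : syz PA i ⟶ syz PB k} (hf : Induces φ i k h f)
    {f' : syz PA (i + 1) ⟶ syz PB (k + 1)} (hf' : Induces φ (i + 1) (k + 1) h' f') :
    stableNext PA PB i k (stableMk f) = n.negOnePow • stableMk f' := by
  rw [← map_units_smul]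
  refine stableNext_mk PA PB hf ?_
  rw [← cancel_epi (syzπ PA (i + 1)), Linear.units_smul_comp, Linear.comp_units_smul,
    ← Category.assoc, ← hf', Category.assoc, syzπ_syzι, hφ.component_comp_d i k h hk, smul_smul,
    ← syzπ_syzι, Category.assoc]
  simp

theorem stageSign_succ (n : ℤ) (k : ℕ) :
    stageSign n (k + 1) = stageSign n k * n.negOnePow := by
  rw [stageSign, stageSign, ← Int.negOnePow_add]
  congr 1
  push_cast
  ring

theorem stageSign_mul_self (n : ℤ) (k : ℕ) : stageSign n k * stageSign n k = 1 :=
  Int.units_mul_self _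

/-- The exponents agree because `(m+n)(m+n-1)/2 = m(m-1)/2 + n(n-1)/2 + mn` and `mj = mn + mk`.
Compatibility with products is the purpose of the quadratic term in the sign. -/
theorem stageSign_add (m n : ℤ) (j k : ℕ) (hjk : (j : ℤ) = n + k) :
    stageSign (m + n) k = stageSign n k * stageSign m j := by
  -- The integer division is exact, since a product of consecutive integers is even.
  have key : ∀ a : ℤ, 2 * (a * (a - 1) / 2) = a * (a - 1) := fun a =>
    Int.mul_ediv_cancel' (by simpa using (Int.even_mul_pred_self a).two_dvd)
  rw [stageSign, stageSign, stageSign, ← Int.negOnePow_add]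
  congr 1
  have h₁ := key (m + n)
  have h₂ := key m
  have h₃ := key n
  rw [hjk]
  linarith

theorem IsChainMapFrom.naiveOf_add {n : ℤ} {φ : Hyp PA PB n} {K : ℕ}
    (hφ : IsChainMapFrom φ K) {i k : ℕ} {h : (i : ℤ) = n + k} (hk : K ≤ k) (l : ℕ)
    {h' : ((i + l : ℕ) : ℤ) = n + (k + l : ℕ)}
    {f : syz PA i ⟶ syz PB k} (hf : Induces φ i k h f)
    {f' : syz PA (i + l) ⟶ syz PB (k + l)} (hf' : Induces φ (i + l) (k + l) h' f') :
    stageSign n (k + l) • naiveOf PA PB n (i + l) (k + l) h' (stableMk f') =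
      stageSign n k • naiveOf PA PB n i k h (stableMk f) := by
  induction l with
  | zero => rw [hf.unique hf']; rfl
  | succ l ih =>
    obtain ⟨g, hg⟩ := hφ.exists_induces (i + l) (k + l) (by omega) (by omega)
    have h₁ := hφ.stableNext_stableMk (by omega) hg hf'
    rw [← ih hg, ← naiveOf_stableNext _ (i := i + l) (k := k + l) h', h₁, map_units_smul, smul_smul,
      ← stageSign_succ]
    rfl

/-- A version of `IsChainMapFrom.naiveOf_add` before passage to the limit. It only serves to
transfer vanishing, so the sign is left unspecified. -/
theorem IsChainMapFrom.transition_stableMk {n : ℤ} {φ : Hyp PA PB n} {K : ℕ}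
    (hφ : IsChainMapFrom φ K) {i k : ℕ} {h : (i : ℤ) = n + k} (hk : K ≤ k) (l : ℕ)
    {h' : ((i + l : ℕ) : ℤ) = n + (k + l : ℕ)}
    {f : syz PA i ⟶ syz PB k} (hf : Induces φ i k h f)
    {f' : syz PA (i + l) ⟶ syz PB (k + l)} (hf' : Induces φ (i + l) (k + l) h' f') :
    ∃ a : ℤˣ, transition PA PB l rfl rfl (stableMk f) = a • stableMk f' := by
  induction l with
  | zero => exact ⟨1, by rw [hf.unique hf', one_smul]; rfl⟩
  | succ l ih =>
    obtain ⟨g, hg⟩ := hφ.exists_induces (i + l) (k + l) (by omega) (by omega)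
    obtain ⟨a, ha⟩ := ih hg
    refine ⟨a * n.negOnePow, ?_⟩
    rw [transition_succ PA PB l rfl rfl rfl rfl, ha, map_units_smul,
      hφ.stableNext_stableMk (by omega) hg hf', smul_smul]
    rfl

/-! ## The comparison homomorphism on almost chain maps -/

/-- At all stages `k ≥ K` the family `φ` induces a morphism between the syzygies which represents
`z`, up to the sign `stageSign n k`. -/
def RepresentsFrom {n : ℤ} (φ : Hyp PA PB n) (z : NaiveExt PA PB n) (K : ℕ) : Prop :=
  ∀ (i k : ℕ) (h : (i : ℤ) = n + k), K ≤ k → ∃ f, Induces φ i k h f ∧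
    stageSign n k • naiveOf PA PB n i k h (stableMk f) = z

theorem RepresentsFrom.add {n : ℤ} {φ ψ : Hyp PA PB n} {z w : NaiveExt PA PB n} {K L : ℕ}
    (hφ : RepresentsFrom φ z K) (hψ : RepresentsFrom ψ w L) :
    RepresentsFrom (φ + ψ) (z + w) (K + L) := by
  intro i k h hk
  obtain ⟨f, hf, rfl⟩ := hφ i k h (by omega)
  obtain ⟨g, hg, rfl⟩ := hψ i k h (by omega)
  exact ⟨f + g, hf.add hg, by rw [map_add, map_add]; exact units_smul_add _ _ _⟩

theorem RepresentsFrom.unique {n : ℤ} {φ : Hyp PA PB n} {z w : NaiveExt PA PB n} {K L : ℕ}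
    (hz : RepresentsFrom φ z K) (hw : RepresentsFrom φ w L) : z = w := by
  obtain ⟨i, -, k, -, -, h, hk, -, -⟩ := exists_common_stage n 0 (K + L)
  obtain ⟨f, hf, rfl⟩ := hz i k (by omega) (by omega)
  obtain ⟨g, hg, rfl⟩ := hw i k (by omega) (by omega)
  rw [hf.unique hg]

theorem IsChainMapFrom.exists_representsFrom {n : ℤ} {φ : Hyp PA PB n} {K : ℕ}
    (hφ : IsChainMapFrom φ K) : ∃ z, RepresentsFrom φ z K := by
  obtain ⟨i₀, -, k₀, -, -, h₀, hk₀, -, -⟩ := exists_common_stage n 0 K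
  obtain ⟨f₀, hf₀⟩ := hφ.exists_induces i₀ k₀ (by omega) hk₀
  refine ⟨stageSign n k₀ • naiveOf PA PB n i₀ k₀ (by omega) (stableMk f₀), fun i k h hk => ?_⟩
  obtain ⟨f, hf⟩ := hφ.exists_induces i k h hk
  refine ⟨f, hf, ?_⟩
  rcases le_total k k₀ with hle | hle
  · obtain ⟨l, rfl⟩ := Nat.exists_eq_add_of_le hle
    obtain rfl : i₀ = i + l := by omega
    exact (hφ.naiveOf_add hk l hf hf₀).symm
  · obtain ⟨l, rfl⟩ := Nat.exists_eq_add_of_le hle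
    obtain rfl : i = i₀ + l := by omega
    exact hφ.naiveOf_add hk₀ l hf₀ hf

/-- The group of almost chain maps of degree `n`. -/
def almostChainMaps (PA : ProjectiveResolution A) (PB : ProjectiveResolution B) (n : ℤ) :
    AddSubgroup (Hyp PA PB n) :=
  (bdd PA PB (n + 1)).comap
    (δ_hom ℤ PA.cochainComplex PB.cochainComplex n (n + 1)).toAddMonoidHom

theorem exists_representsFrom {n : ℤ} (φ : almostChainMaps PA PB n) :
    ∃ z K, RepresentsFrom φ.1 z K := by
  obtain ⟨K, hK⟩ := (isAlmostChainMap_iff φ.1).1 φ.2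
  obtain ⟨z, hz⟩ := hK.exists_representsFrom
  exact ⟨z, K, hz⟩

/-- The element of the direct limit which is represented by an almost chain map. -/
def toNaive (PA : ProjectiveResolution A) (PB : ProjectiveResolution B) (n : ℤ) :
    almostChainMaps PA PB n →+ NaiveExt PA PB n :=
  AddMonoidHom.mk' (fun φ => (exists_representsFrom φ).choose) fun φ ψ =>
    (exists_representsFrom (φ + ψ)).choose_spec.choose_spec.unique
      ((exists_representsFrom φ).choose_spec.choose_spec.add
        (exists_representsFrom ψ).choose_spec.choose_spec)

theorem toNaive_eq {n : ℤ} {φ : almostChainMaps PA PB n} {z : NaiveExt PA PB n} {K : ℕ}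
    (hz : RepresentsFrom φ.1 z K) : toNaive PA PB n φ = z :=
  (exists_representsFrom φ).choose_spec.choose_spec.unique hz

/-- The threshold hidden in the choice made by `toNaive` is replaced by any `K` from which `φ`
commutes with the differentials. -/
theorem representsFrom_toNaive {n : ℤ} {φ : almostChainMaps PA PB n} {K : ℕ}
    (hφ : IsChainMapFrom φ.1 K) : RepresentsFrom φ.1 (toNaive PA PB n φ) K := by
  obtain ⟨z, hz⟩ := hφ.exists_representsFrom
  rwa [toNaive_eq hz]

/-! ### Surjectivity and kernels of the two projections. -/

/-- The projection of the almost chain maps onto their classes. -/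
def toVogel (PA : ProjectiveResolution A) (PB : ProjectiveResolution B) (n : ℤ) :
    almostChainMaps PA PB n →+ VogelExt PA PB n :=
  AddMonoidHom.mk' (fun φ => vogelMk φ.1 φ.2) fun _ _ => rfl

theorem toVogel_surjective (n : ℤ) : Function.Surjective (toVogel PA PB n) := by
  intro x
  obtain ⟨⟨y, hy⟩, rfl⟩ := QuotientAddGroup.mk_surjective x
  obtain ⟨φ, rfl⟩ := QuotientAddGroup.mk_surjective y
  exact ⟨⟨φ, (QuotientAddGroup.eq_zero_iff (δ n (n + 1) φ)).1 hy⟩, rfl⟩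

theorem toVogel_eq_zero_iff {n : ℤ} (φ : almostChainMaps PA PB n) :
    toVogel PA PB n φ = 0 ↔ ∃ ψ : Hyp PA PB (n - 1), φ.1 - δ (n - 1) n ψ ∈ bdd PA PB n := by
  refine (QuotientAddGroup.eq_zero_iff _).trans ?_
  rw [AddSubgroup.mem_addSubgroupOf]
  constructor
  · rintro ⟨y, hy⟩
    obtain ⟨ψ, rfl⟩ := QuotientAddGroup.mk_surjective y
    exact ⟨ψ, QuotientAddGroup.eq_iff_sub_mem.1 hy.symm⟩
  · rintro ⟨ψ, hψ⟩
    exact ⟨QuotientAddGroup.mk ψ, (QuotientAddGroup.eq_iff_sub_mem.2 hψ).symm⟩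

/-- At high stages `φ` is the coboundary of `ψ`. The summand of the coboundary ending in the
differential dies under the projection, and the other one induces a morphism through a projective
term of the resolution of `A`. -/
theorem toNaive_eq_zero_of_sub_mem_bdd {n : ℤ} {φ : almostChainMaps PA PB n}
    {ψ : Hyp PA PB (n - 1)} (hψ : φ.1 - δ (n - 1) n ψ ∈ bdd PA PB n) :
    toNaive PA PB n φ = 0 := by
  obtain ⟨N, hN⟩ := (mem_bdd_iff _).1 hψ
  refine toNaive_eq (K := N + n.natAbs + 1) fun i k h hk => ?_
  obtain ⟨i, rfl⟩ : ∃ i' : ℕ, i = i' + 1 := ⟨i - 1, by omega⟩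
  have h₀ := hN (i + 1) k h (by omega)
  rw [component_sub, sub_eq_zero, component_δ ψ i k (by omega) n (by omega)] at h₀
  refine ⟨n.negOnePow • syzι PA i ≫ component ψ i k (by omega) ≫ syzπ PB k, ?_, ?_⟩
  · rw [Induces, h₀, Preadditive.add_comp, Category.assoc, d_syzπ, comp_zero, zero_add,
      Linear.units_smul_comp, Linear.comp_units_smul, ← syzπ_syzι]
    simp only [Category.assoc]
  · have hmem : syzι PA i ≫ component ψ i k (by omega) ≫ syzπ PB k ∈ projSubgroup _ _ :=
      ⟨PA.complex.X i, inferInstance, _, _, rfl⟩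
    have h0 : stableMk (syzι PA i ≫ component ψ i k (by omega) ≫ syzπ PB k) = 0 :=
      (QuotientAddGroup.eq_zero_iff _).2 hmem
    rw [map_units_smul, h0, units_smul_eq_zero.2 rfl, map_zero]
    exact units_smul_eq_zero.2 rfl

/-- Recursive construction of a cochain. -/
theorem exists_cochain_of_step {n : ℤ} {i₀ k₀ : ℕ} (h₀ : (i₀ : ℤ) = n + k₀)
    (Q : ∀ i k : ℕ, (i : ℤ) = n + k → (PA.complex.X i ⟶ PB.complex.X k) → Prop)
    (R : ∀ i k : ℕ, (i : ℤ) = n + k → (PA.complex.X i ⟶ PB.complex.X k) →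
      (PA.complex.X (i + 1) ⟶ PB.complex.X (k + 1)) → Prop)
    (g₀ : PA.complex.X i₀ ⟶ PB.complex.X k₀) (hg₀ : Q i₀ k₀ h₀ g₀)
    (step : ∀ (i k : ℕ) (h : (i : ℤ) = n + k) (g : PA.complex.X i ⟶ PB.complex.X k), k₀ ≤ k →
      Q i k h g → ∃ g', R i k h g g' ∧ Q (i + 1) (k + 1) (by omega) g') :
    ∃ φ : Hyp PA PB n, component φ i₀ k₀ h₀ = g₀ ∧
      ∀ (i k : ℕ) (h : (i : ℤ) = n + k), k₀ ≤ k →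
        R i k h (component φ i k h) (component φ (i + 1) (k + 1) (by omega)) := by
  choose next hnext using step
  -- The invariant `Q` is carried along with each member because the next step needs it.
  let F : ∀ j : ℕ, {g : PA.complex.X (i₀ + j) ⟶ PB.complex.X (k₀ + j) //
      Q (i₀ + j) (k₀ + j) (by omega) g} := fun j =>
    Nat.rec ⟨g₀, hg₀⟩ (fun j g => ⟨next (i₀ + j) (k₀ + j) (by omega) g.1 (by omega) g.2,
      (hnext (i₀ + j) (k₀ + j) (by omega) g.1 (by omega) g.2).2⟩) j
  have hF : ∀ j, R (i₀ + j) (k₀ + j) (by omega) (F j).1 (F (j + 1)).1 := fun j =>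
    (hnext (i₀ + j) (k₀ + j) (by omega) (F j).1 (by omega) (F j).2).1
  -- Members below `k₀` are set to zero; no condition is imposed on them.
  let G : ∀ (i k : ℕ), (i : ℤ) = n + k → (PA.complex.X i ⟶ PB.complex.X k) := fun i k h =>
    if hk : k₀ ≤ k then
      eqToHom (by congr 1; omega) ≫ (F (k - k₀)).1 ≫ eqToHom (by congr 1; omega)
    else 0
  have hG : ∀ (j : ℕ) (h : ((i₀ + j : ℕ) : ℤ) = n + (k₀ + j : ℕ)),
      G (i₀ + j) (k₀ + j) h = (F j).1 := by
    intro j h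
    have key : ∀ (l : ℕ) (hl : l = j), eqToHom (by rw [hl]) ≫ (F l).1 ≫ eqToHom (by rw [hl]) =
        (F j).1 := by
      rintro _ rfl
      simp
    dsimp only [G]
    rw [dif_pos (by omega)]
    exact key _ (by omega)
  refine ⟨ofComponents G, ?_, fun i k h hk => ?_⟩
  · rw [component_ofComponents]
    exact hG 0 h₀
  · obtain ⟨j, rfl⟩ := Nat.exists_eq_add_of_le hk
    obtain rfl : i = i₀ + j := by omega
    rw [component_ofComponents, component_ofComponents, hG j h]
    convert hF j
    exact hG (j + 1) (by omega)

theorem toNaive_surjective (n : ℤ) : Function.Surjective (toNaive PA PB n) := by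
  intro z
  obtain ⟨i₀, k₀, h₀, x, rfl⟩ := exists_naiveOf z
  obtain ⟨f₀, rfl⟩ := QuotientAddGroup.mk'_surjective _ x
  obtain ⟨φ, hφ₀, hφ⟩ := exists_cochain_of_step (PA := PA) (PB := PB) h₀
    (fun i k _ g => ∃ f, g ≫ syzπ PB k = syzπ PA i ≫ f)
    (fun i k _ g g' => g' ≫ PB.complex.d (k + 1) k = n.negOnePow • PA.complex.d (i + 1) i ≫ g)
    -- The starting morphism is multiplied by the sign of its stage, which cancels against the sign
    -- in `RepresentsFrom`.
    (liftMap PA PB (stageSign n k₀ • f₀)) ⟨_, liftMap_syzπ _ _ _⟩ (by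
      rintro i k h g - ⟨f, hf⟩
      have h0 : (syzι PA i ≫ g) ≫ syzπ PB k = 0 := by simp [hf]
      refine ⟨liftMap PA PB (n.negOnePow • syzLift PB k (syzι PA i ≫ g) h0), ?_,
        _, liftMap_syzπ _ _ _⟩
      rw [← syzπ_syzι, ← Category.assoc, liftMap_syzπ, Category.assoc, Linear.units_smul_comp,
        syzLift_syzι, Linear.comp_units_smul, ← Category.assoc, syzπ_syzι])
  have hchain : IsChainMapFrom φ k₀ := by
    refine (isChainMapFrom_iff _ _).2 fun i k h hk => ?_
    -- Here `i = (n + k) + 1` and `n + k ≥ n + k₀ = i₀ ≥ 0`.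
    obtain ⟨i, rfl⟩ : ∃ i' : ℕ, i = i' + 1 := ⟨i - 1, by omega⟩
    rw [component_δ φ i k (by omega) _ rfl, hφ i k (by omega) hk, Int.negOnePow_succ]
    simp
  refine ⟨⟨φ, (isAlmostChainMap_iff φ).2 ⟨k₀, hchain⟩⟩, ?_⟩
  obtain ⟨f, hf, hz⟩ := representsFrom_toNaive
    (φ := ⟨φ, (isAlmostChainMap_iff φ).2 ⟨k₀, hchain⟩⟩) hchain i₀ k₀ h₀ le_rfl
  have hf₀ : Induces φ i₀ k₀ h₀ (stageSign n k₀ • f₀) := by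
    rw [Induces, hφ₀, liftMap_syzπ]
  rw [← hz, hf.unique hf₀, map_units_smul, map_units_smul, smul_smul, stageSign_mul_self, one_smul]

theorem exists_sub_mem_bdd_of_toNaive_eq_zero {n : ℤ} {φ : almostChainMaps PA PB n}
    (hz : toNaive PA PB n φ = 0) :
    ∃ ψ : Hyp PA PB (n - 1), φ.1 - δ (n - 1) n ψ ∈ bdd PA PB n := by
  obtain ⟨K, hK⟩ := (isAlmostChainMap_iff φ.1).1 φ.2
  obtain ⟨φ, hφ⟩ := φ
  dsimp only at hK ⊢
  -- Vanishing in the limit means vanishing after finitely many transitions, so at a later stage the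
  -- induced morphism itself factors through a projective.
  obtain ⟨i, k, h, f, hk, hf, P, hP, a, b, hab⟩ : ∃ (i k : ℕ) (h : (i : ℤ) = n + k)
      (f : syz PA i ⟶ syz PB k), K ≤ k ∧ Induces φ i k h f ∧ f ∈ projSubgroup _ _ := by
    obtain ⟨i, -, k, -, -, h, hk, -, -⟩ := exists_common_stage n 0 K
    obtain ⟨f, hf, h0⟩ := representsFrom_toNaive (φ := ⟨φ, hφ⟩) hK i k (by omega) hk
    rw [hz] at h0
    replace h0 := units_smul_eq_zero.1 h0
    obtain ⟨l, hl⟩ := exists_transition_eq_zero _ h0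
    obtain ⟨f', hf'⟩ := hK.exists_induces (i + l) (k + l) (by omega) (by omega)
    obtain ⟨c, hc⟩ := hK.transition_stableMk hk l hf hf'
    rw [hl, eq_comm, units_smul_eq_zero] at hc
    exact ⟨i + l, k + l, by omega, f', by omega, hf', (QuotientAddGroup.eq_zero_iff _).1 hc⟩
  -- Lifting `b` to `PB_k` gives a second lift of `f` through `P`. Its difference from `φ_k` is
  -- killed by the projection, hence factors through the differential; this is the first member of
  -- the homotopy.
  obtain ⟨g₀, hg₀⟩ := exists_lift_d PB k
    (component φ i k h - syzπ PA i ≫ a ≫ Projective.factorThru b (syzπ PB k)) (by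
      rw [Preadditive.sub_comp, hf, ← hab]
      simp)
  obtain ⟨ψ, -, hψ⟩ := exists_cochain_of_step (PA := PA) (PB := PB) (n := n - 1)
    (i₀ := i) (k₀ := k + 1) (by omega)
    (fun i k h g => (component φ (i + 1) k (by omega) -
      n.negOnePow • PA.complex.d (i + 1) i ≫ g) ≫ syzπ PB k = 0)
    (fun i k h g g' => g' ≫ PB.complex.d (k + 1) k = component φ (i + 1) k (by omega) -
      n.negOnePow • PA.complex.d (i + 1) i ≫ g)
    -- The correction through `P` starts with the projection from `PA_i`, so precomposing it with
    -- the differential gives zero.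
    g₀ (by
      rw [← cancel_mono (syzι PB k), Category.assoc, syzπ_syzι, zero_comp, Preadditive.sub_comp,
        hK.component_comp_d i k h hk, Linear.units_smul_comp, Category.assoc, hg₀,
        Preadditive.comp_sub]
      simp) (by
      intro i' k' h' g hk' hg
      obtain ⟨g', hg'⟩ := exists_lift_d PB k' _ hg
      refine ⟨g', hg', ?_⟩
      rw [← cancel_mono (syzι PB k'), Category.assoc, syzπ_syzι, zero_comp, Preadditive.sub_comp,
        hK.component_comp_d (i' + 1) k' (by omega) (by omega), Linear.units_smul_comp,
        Category.assoc, hg', Preadditive.comp_sub]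
      simp)
  -- The homotopy relation holds from `k + 1` on; the summand `|n|` makes the source index positive.
  refine ⟨ψ, (mem_bdd_iff _).2 ⟨k + 1 + n.natAbs, fun i' k' h' hk' => ?_⟩⟩
  obtain ⟨i', rfl⟩ : ∃ l : ℕ, i' = l + 1 := ⟨i' - 1, by omega⟩
  rw [component_sub, component_δ ψ i' k' (by omega) n (by omega), hψ i' k' (by omega) (by omega)]
  simp

theorem ker_toVogel_eq_ker_toNaive (n : ℤ) : (toVogel PA PB n).ker = (toNaive PA PB n).ker := by
  ext φ
  rw [AddMonoidHom.mem_ker, AddMonoidHom.mem_ker, toVogel_eq_zero_iff]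
  exact ⟨fun ⟨_, hψ⟩ => toNaive_eq_zero_of_sub_mem_bdd hψ, exists_sub_mem_bdd_of_toNaive_eq_zero⟩

/-- The comparison isomorphism. -/
def comparison (PA : ProjectiveResolution A) (PB : ProjectiveResolution B) (n : ℤ) :
    VogelExt PA PB n ≃+ NaiveExt PA PB n :=
  ((QuotientAddGroup.quotientKerEquivOfSurjective _ (toVogel_surjective n)).symm.trans
    (QuotientAddGroup.quotientAddEquivOfEq (ker_toVogel_eq_ker_toNaive n))).trans
    (QuotientAddGroup.quotientKerEquivOfSurjective _ (toNaive_surjective n))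

theorem comparison_vogelMk {n : ℤ} (φ : Hyp PA PB n) (hφ : IsAlmostChainMap φ) :
    comparison PA PB n (vogelMk φ hφ) = toNaive PA PB n ⟨φ, hφ⟩ := by
  have h : (QuotientAddGroup.quotientKerEquivOfSurjective _ (toVogel_surjective n)).symm
      (vogelMk φ hφ) = QuotientAddGroup.mk (⟨φ, hφ⟩ : almostChainMaps PA PB n) := by
    rw [AddEquiv.symm_apply_eq]
    rfl
  rw [comparison, AddEquiv.trans_apply, AddEquiv.trans_apply, h]
  rfl

theorem representsFrom_comparison {n : ℤ} {φ : Hyp PA PB n} (hφ : IsAlmostChainMap φ) {K : ℕ}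
    (hK : IsChainMapFrom φ K) : RepresentsFrom φ (comparison PA PB n (vogelMk φ hφ)) K := by
  rw [comparison_vogelMk]
  exact representsFrom_toNaive (φ := ⟨φ, hφ⟩) hK

/-! ## The product of the hypercohomology construction -/

theorem comparison_vogelMk_comp {m n : ℤ} {f : Hyp PA PB m} {g : Hyp PB PD n}
    (hf : IsAlmostChainMap f) (hg : IsAlmostChainMap g) :
    comparison PA PD (m + n) (vogelMk (f.comp g rfl) (isAlmostChainMap_comp hf hg)) =
      naiveComp PA PB PD m n (comparison PB PD n (vogelMk g hg))
        (comparison PA PB m (vogelMk f hf)) := by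
  obtain ⟨K, hK⟩ := (isAlmostChainMap_iff f).1 hf
  obtain ⟨L, hL⟩ := (isAlmostChainMap_iff g).1 hg
  obtain ⟨N, hN⟩ := (isAlmostChainMap_iff _).1 (isAlmostChainMap_comp hf hg)
  obtain ⟨i, j, k, hjk, hij, hik, hk, hj, -⟩ := exists_common_stage m n (K + L + N)
  obtain ⟨u, hu, hu'⟩ := representsFrom_comparison hf hK i j hij (by omega)
  obtain ⟨w, hw, hw'⟩ := representsFrom_comparison hg hL j k hjk (by omega)
  obtain ⟨t, ht, ht'⟩ := representsFrom_comparison (isAlmostChainMap_comp hf hg) hN i k hik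
    (by omega)
  -- At a common stage the composite induces the composite of the induced morphisms, so only the
  -- signs remain to be compared.
  rw [← ht', ← hu', ← hw', ht.unique (hu.comp hw hik), map_units_smul (naiveComp PA PB PD m n),
    Units.smul_def (stageSign n k), AddMonoidHom.zsmul_apply, ← Units.smul_def,
    map_units_smul (naiveComp PA PB PD m n _), naiveComp_naiveOf hjk hij hik, stableComp_mk,
    smul_smul, stageSign_add m n j k hjk]

/-- The composition product of the hypercohomology construction on the tensor product. -/
def vogelProd (PA : ProjectiveResolution A) (PB : ProjectiveResolution B)
    (PD : ProjectiveResolution D) (m n : ℤ) :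
    VogelExt PB PD n ⊗[ℤ] VogelExt PA PB m →+ VogelExt PA PD (m + n) :=
  -- Transport along the isomorphisms makes well-definedness on classes and biadditivity automatic.
  (comparison PA PD (m + n)).symm.toAddMonoidHom.comp
    ((naiveProd PA PB PD m n).comp
      (TensorProduct.map (comparison PB PD n).toAddMonoidHom.toIntLinearMap
        (comparison PA PB m).toAddMonoidHom.toIntLinearMap).toAddMonoidHom)

theorem comparison_vogelProd_tmul {m n : ℤ} (y : VogelExt PB PD n) (x : VogelExt PA PB m) :
    comparison PA PD (m + n) (vogelProd PA PB PD m n (y ⊗ₜ[ℤ] x)) =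
      naiveProd PA PB PD m n (comparison PB PD n y ⊗ₜ[ℤ] comparison PA PB m x) :=
  (comparison PA PD (m + n)).apply_symm_apply _

end CompletedExt

end

theorem theorem5p4 {C : Type u} [Category.{v} C] [Abelian C] [EnoughProjectives C] :
    ∃ θ : ∀ {A B : C} (PA : ProjectiveResolution A) (PB : ProjectiveResolution B) (n : ℤ),
        CompletedExt.VogelExt PA PB n ≃+ CompletedExt.NaiveExt PA PB n,
      (∀ {A B : C} (PA : ProjectiveResolution A) (PB : ProjectiveResolution B) (n : ℤ)
        (φ : CompletedExt.Hyp PA PB n) (hφ : CompletedExt.IsAlmostChainMap φ) (K : ℕ),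
        CompletedExt.IsChainMapFrom φ K →
        ∀ (i k : ℕ) (h : (i : ℤ) = n + k), K ≤ k →
          ∃ f : CompletedExt.syz PA i ⟶ CompletedExt.syz PB k,
            CompletedExt.component φ i k h ≫ CompletedExt.syzπ PB k =
              CompletedExt.syzπ PA i ≫ f ∧
            θ PA PB n (CompletedExt.vogelMk φ hφ) =
              CompletedExt.stageSign n k •
                CompletedExt.naiveOf PA PB n i k h (CompletedExt.stableMk f)) ∧
      ∀ {F H J : C} (PF : ProjectiveResolution F) (PH : ProjectiveResolution H)
        (PJ : ProjectiveResolution J) (m n : ℤ),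
        ∃ (μ : CompletedExt.VogelExt PH PJ n ⊗[ℤ] CompletedExt.VogelExt PF PH m →+
            CompletedExt.VogelExt PF PJ (m + n))
          (ν : CompletedExt.NaiveExt PH PJ n ⊗[ℤ] CompletedExt.NaiveExt PF PH m →+
            CompletedExt.NaiveExt PF PJ (m + n)),
          (∀ (g : CompletedExt.Hyp PH PJ n) (hg : CompletedExt.IsAlmostChainMap g)
            (f : CompletedExt.Hyp PF PH m) (hf : CompletedExt.IsAlmostChainMap f),
            ∃ hgf : CompletedExt.IsAlmostChainMap (f.comp g rfl),
              μ (CompletedExt.vogelMk g hg ⊗ₜ[ℤ] CompletedExt.vogelMk f hf) =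
                CompletedExt.vogelMk (f.comp g rfl) hgf) ∧
          (∀ (i j k : ℕ) (hjk : (j : ℤ) = n + k) (hij : (i : ℤ) = m + j)
            (hik : (i : ℤ) = (m + n) + k)
            (y : CompletedExt.StableHom (CompletedExt.syz PH j) (CompletedExt.syz PJ k))
            (x : CompletedExt.StableHom (CompletedExt.syz PF i) (CompletedExt.syz PH j)),
            ν (CompletedExt.naiveOf PH PJ n j k hjk y ⊗ₜ[ℤ]
                CompletedExt.naiveOf PF PH m i j hij x) =
              CompletedExt.naiveOf PF PJ (m + n) i k hik
                (CompletedExt.stableComp _ _ _ y x)) ∧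
          (∀ (y : CompletedExt.VogelExt PH PJ n) (x : CompletedExt.VogelExt PF PH m),
            θ PF PJ (m + n) (μ (y ⊗ₜ[ℤ] x)) =
              ν (θ PH PJ n y ⊗ₜ[ℤ] θ PF PH m x)) := by
  refine ⟨fun PA PB n => CompletedExt.comparison PA PB n, ?_, ?_⟩
  · intro A B PA PB n φ hφ K hK i k h hk
    obtain ⟨f, hf, hz⟩ := CompletedExt.representsFrom_comparison hφ hK i k h hk
    exact ⟨f, hf, hz.symm⟩
  · intro F H J PF PH PJ m n
    refine ⟨CompletedExt.vogelProd PF PH PJ m n, CompletedExt.naiveProd PF PH PJ m n, ?_, ?_, ?_⟩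
    · intro g hg f hf
      -- The formula on representatives is checked after applying the injective comparison map.
      refine ⟨CompletedExt.isAlmostChainMap_comp hf hg,
        (CompletedExt.comparison PF PJ (m + n)).injective ?_⟩
      rw [CompletedExt.comparison_vogelProd_tmul, CompletedExt.comparison_vogelMk_comp,
        CompletedExt.naiveProd_tmul]
    · intro i j k hjk hij hik y x
      rw [CompletedExt.naiveProd_tmul, CompletedExt.naiveComp_naiveOf hjk hij hik]
    · exact CompletedExt.comparison_vogelProd_tmul
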